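/- Let $k\ge 1$ and $k\le d\le 2k-1$ be integers, put $n=2k-1$ and $m=d-k+1$, let $q>n$ be a prime, and let $x_1,\dots,x_n\in\mathbb F_q$ be distinct and nonzero. Let $V=(x_i^{a-1})_{1\le i\le n,\,1\le a\le d}$ be the $n\times d$ Vandermonde matrix. For $\underline s=(s_1,\dots,s_m)\in\mathbb F_q^m$ and $\underline r=(\underline r_1,\dots,\underline r_m)$ with $\underline r_j\in\mathbb F_q^{k-1}$, let $\underline v=(v_1,\dots,v_{m-1})$ be the vector of the last $m-1$ entries of $\underline r_1$, and let $M=M(\underline s,\underline r)$ be the $d\times m$ matrix whose first column is $(\underline s,\underline r_1)$ and whose $j$-th column, for $2\le j\le m$, is $(0,\dots,0,v_{j-1},\underline r_j)$ with $m-1$ leading zeros. Put $(c_{ij})=VM$ and define an encoding of $m$ qudits of dimension $q$ into $n$ shares of $m$ qudits each by linear extension of $$\mathcal E:\ |s_1\cdots s_m\rangle\ \longmapsto\ \frac{1}{\sqrt{q^{m(k-1)}}}\sum_{\underline r\in\mathbb F_q^{m(k-1)}}\ \bigotimes_{i=1}^{n}|c_{i1}c_{i2}\cdots c_{im}\rangle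 ,$$ the $i$-th tensor factor being the share of participant $i$. Call a set $A$ of the $nm$ encoded qudits sufficient to recover the secret if there is one quantum channel (completely positive trace preserving map) that sends the reduced state on $A$ of $\mathcal E\rho\,\mathcal E^\dagger$ to $\rho$ for every density operator $\rho$ of the secret; say that $A$ has no information about the secret if that reduced state is the same for all $\rho$. Then $\mathcal E$ is a $((k,2k-1,d))$ quantum threshold secret sharing scheme for a secret of $m$ qudits, that is: 1. $\mathcal E$ is an isometry. The shares of any $k$ or more participants are sufficient to recover the secret. The shares of any $k-1$ or fewer participants have no information about the secret. If the shares of a set of participants are sufficient to recover the secret, then the shares of the complementary set have no information about it. 2. Any $k$ participants can recover the secret by communicating all the qudits of their shares, $mk$ qudits in total. 3. Any $d$ participants can recover the secret by communicating only the first qudit of each of their shares, $d$ qudits in total. If $d>k$, then $d<mk$. -/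

import Mathlib

open scoped BigOperators Matrix ComplexOrder

noncomputable section

namespace QSS

/-! ## States, partial trace, channels

A system of qudits labelled by `ι`, each with standard basis labelled by `F`, has standard basis
labelled by `ι → F`; operators on it are complex matrices indexed by `ι → F`. -/

/-- A density operator: positive semidefinite of trace one. -/
structure IsDensity {X : Type*} [Fintype X] (ρ : Matrix X X ℂ) : Prop where
  posSemidef : ρ.PosSemidef
  trace_eq_one : ρ.trace = 1

/-- The map `Φ ⊗ id` on operators of a bipartite system, where `Φ` acts on the first factor and
the second factor has dimension `N`. -/
def ampliation {X Y : Type*} (Φ : Matrix X X ℂ →ₗ[ℂ] Matrix Y Y ℂ) (N : ℕ)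
    (ρ : Matrix (X × Fin N) (X × Fin N) ℂ) : Matrix (Y × Fin N) (Y × Fin N) ℂ :=
  Matrix.of fun p p' =>
    Φ (Matrix.of fun x x' => ρ (x, p.2) (x', p'.2)) p.1 p'.1

/-- A quantum channel: a completely positive trace preserving linear map. -/
structure IsQuantumChannel {X Y : Type*} [Fintype X] [Fintype Y]
    (Φ : Matrix X X ℂ →ₗ[ℂ] Matrix Y Y ℂ) : Prop where
  completelyPositive : ∀ (N : ℕ) (ρ : Matrix (X × Fin N) (X × Fin N) ℂ),
    ρ.PosSemidef → (ampliation Φ N ρ).PosSemidef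
  tracePreserving : ∀ ρ : Matrix X X ℂ, (Φ ρ).trace = ρ.trace

/-- The basis label of the whole system whose restriction to the qudits in `A` is `a` and whose
restriction to the other qudits is `e`. -/
def glue {ι F : Type*} [DecidableEq ι] (A : Finset ι)
    (a : {i // i ∈ A} → F) (e : {i // i ∉ A} → F) : ι → F :=
  (Equiv.piEquivPiSubtypeProd (fun i => i ∈ A) (fun _ => F)).symm (a, e)

/-- The reduced state on the qudits in `A`: the partial trace over all qudits outside `A`. -/
def reduced {ι F : Type*} [Fintype ι] [DecidableEq ι] [Fintype F] (A : Finset ι)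
    (ρ : Matrix (ι → F) (ι → F) ℂ) :
    Matrix ({i // i ∈ A} → F) ({i // i ∈ A} → F) ℂ :=
  Matrix.of fun a b => ∑ e : {i // i ∉ A} → F, ρ (glue A a e) (glue A b e)

/-! ## Secret sharing

An encoding of a secret system with basis `S` into the qudits `ι` is given by the matrix `E`
whose column `s` is the encoded state of the basis state `s`; a secret state `ρ` is encoded as
`E * ρ * Eᴴ`. -/

/-- From the qudits in `A` alone, every secret state (pure or mixed) can be recovered by one
fixed quantum channel. -/
def CanRecover {ι F S : Type*} [Fintype ι] [DecidableEq ι] [Fintype F] [Fintype S]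
    (E : Matrix (ι → F) S ℂ) (A : Finset ι) : Prop :=
  ∃ Φ : Matrix ({i // i ∈ A} → F) ({i // i ∈ A} → F) ℂ →ₗ[ℂ] Matrix S S ℂ,
    IsQuantumChannel Φ ∧
      ∀ ρ : Matrix S S ℂ, IsDensity ρ → Φ (reduced A (E * ρ * Eᴴ)) = ρ

/-- The qudits in `A` carry no information about the secret: their reduced state is the same for
all secret states. -/
def NoInformation {ι F S : Type*} [Fintype ι] [DecidableEq ι] [Fintype F] [Fintype S]
    (E : Matrix (ι → F) S ℂ) (A : Finset ι) : Prop :=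
  ∃ σ : Matrix ({i // i ∈ A} → F) ({i // i ∈ A} → F) ℂ,
    ∀ ρ : Matrix S S ℂ, IsDensity ρ → reduced A (E * ρ * Eᴴ) = σ

/-- The qudit `(i, j)` is the `j`-th qudit of the `i`-th participant's share.
All the qudits of the participants in `T`. -/
def shareQudits {n m : ℕ} (T : Finset (Fin n)) : Finset (Fin n × Fin m) :=
  T ×ˢ Finset.univ

/-- The first qudits of the shares of the participants in `T`. -/
def firstQudits {n m : ℕ} (T : Finset (Fin n)) : Finset (Fin n × Fin m) :=
  T ×ˢ Finset.univ.filter fun j : Fin m => j.val = 0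

/-- The encoding `E`, of a secret with basis `S` into `n` shares of `m` qudits each, is a (pure
state, perfect) `((k, n))` quantum threshold secret sharing scheme. -/
structure IsThresholdScheme {n m : ℕ} {F S : Type*} [Fintype F] [Fintype S] [DecidableEq S]
    (k : ℕ) (E : Matrix (Fin n × Fin m → F) S ℂ) : Prop where
  /-- `E` is an isometry, so pure states are encoded as (normalized) pure states. -/
  isometry : Eᴴ * E = 1
  /-- Any `k` or more participants can recover the secret. -/
  recover : ∀ T : Finset (Fin n), k ≤ T.card → CanRecover E (shareQudits T)
  /-- Fewer than `k` participants have no information about the secret. -/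
  secrecy : ∀ T : Finset (Fin n), T.card < k → NoInformation E (shareQudits T)
  /-- The complement of an authorized set is unauthorized. -/
  complement : ∀ T : Finset (Fin n),
    CanRecover E (shareQudits T) → NoInformation E (shareQudits Tᶜ)

/-! ## The staircase encoding -/

/-- The `n × d` Vandermonde matrix with rows `1, x i, …, (x i) ^ (d - 1)`. -/
def vandermonde {F : Type*} [Monoid F] {n : ℕ} (x : Fin n → F) (d : ℕ) :
    Matrix (Fin n) (Fin d) F :=
  Matrix.of fun i a => x i ^ a.val

/-- The staircase message matrix of a secret `s` of length `m` and random vectors `r j`, `j < m`,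
of length `k - 1` (everything is indexed from `0`). Its first column is `s` followed by `r 0`.
For `1 ≤ j`, its column `j` consists of `m - 1` zeros, then entry number `j - 1` of the vector
`v` formed by the last `m - 1` entries of `r 0`, then the vector `r j`. -/
def messageMatrix {F : Type*} [Zero F] {k m d : ℕ} (hmk : m ≤ k) (hd : d + 1 = m + k)
    (s : Fin m → F) (r : Fin m → Fin (k - 1) → F) : Matrix (Fin d) (Fin m) F :=
  Matrix.of fun a j =>
    if _hj : j.val = 0 then
      if ha : a.val < m then s ⟨a.val, ha⟩
      else r j ⟨a.val - m, by have := a.isLt; omega⟩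
    else
      if _h₁ : a.val + 1 < m then 0
      else if _h₂ : a.val + 1 = m then
        r ⟨0, j.pos⟩ ⟨k - m + (j.val - 1), by have := j.isLt; omega⟩
      else r j ⟨a.val - m, by have := a.isLt; omega⟩

/-- The basis label whose `(i, j)` entry is the `(i, j)` entry of the product of the Vandermonde
matrix and the message matrix. -/
def codeword {F : Type*} [Semiring F] {k m d : ℕ} (hmk : m ≤ k) (hd : d + 1 = m + k)
    {n : ℕ} (x : Fin n → F) (s : Fin m → F) (r : Fin m → Fin (k - 1) → F) :
    Fin n × Fin m → F :=
  fun p => (vandermonde x d * messageMatrix hmk hd s r) p.1 p.2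

/-- The encoding: column `s` is the normalized uniform superposition, over all `r`, of the basis
states labelled by `codeword hmk hd x s r`. -/
def encoding {F : Type*} [Semiring F] [Fintype F] [DecidableEq F] {k m d : ℕ}
    (hmk : m ≤ k) (hd : d + 1 = m + k) {n : ℕ} (x : Fin n → F) :
    Matrix (Fin n × Fin m → F) (Fin m → F) ℂ :=
  Matrix.of fun c s =>
    ((Real.sqrt ((Fintype.card F : ℝ) ^ (m * (k - 1))))⁻¹ : ℝ) *
      ∑ r : Fin m → Fin (k - 1) → F, if c = codeword hmk hd x s r then (1 : ℂ) else 0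

end QSS

end

/-! The encoding superposes, for each secret, the codewords of an additive code over all random
vectors, so quantum claims reduce to two classical properties of a qudit set: `Determines` (the
codeword there fixes the secret) and `Vanishes` (every secret has a codeword that is zero there). If
one side of a bipartition determines and the other vanishes, the first recovers
(`canRecover_codeEncoding`) and the second learns nothing (`noInformation_codeEncoding`).

For the staircase code, each column of the message matrix lists the coefficients of a polynomial
evaluated at the nonzero nodes `x i`. Later columns lie in a window of `k` consecutive degrees, so
`k` shares kill them; their corner entries then kill the top `m - 1` coefficients of the first
column, leaving `k` unknowns there too. Conversely, the `k - 1` free tail entries of each column can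
be interpolated to cancel any `k - 1` shares. With `d` participants, their first qudits determine
the whole first column, and the `n - d = k - m` other first qudits can be cancelled without using
the entries copied into later columns. -/

namespace QSS

open Matrix Kronecker

set_option linter.unusedSectionVars false

/-! ## Channels in Kraus form -/

section Kraus

variable {X Y W : Type*} [Fintype X] [Fintype Y] [Fintype W]

/-- The completely positive map with Kraus operators `K w`. -/
def krausMap (K : W → Matrix Y X ℂ) : Matrix X X ℂ →ₗ[ℂ] Matrix Y Y ℂ where
  toFun σ := ∑ w, K w * σ * (K w)ᴴ
  map_add' σ τ := by simp [Matrix.mul_add, Matrix.add_mul, Finset.sum_add_distrib]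
  map_smul' c σ := by simp [Finset.smul_sum]

theorem krausMap_apply (K : W → Matrix Y X ℂ) (σ : Matrix X X ℂ) :
    krausMap K σ = ∑ w, K w * σ * (K w)ᴴ := rfl

theorem ampliation_krausMap (K : W → Matrix Y X ℂ) (N : ℕ)
    (ρ : Matrix (X × Fin N) (X × Fin N) ℂ) :
    ampliation (krausMap K) N ρ =
      ∑ w, (K w ⊗ₖ (1 : Matrix (Fin N) (Fin N) ℂ)) * ρ *
        (K w ⊗ₖ (1 : Matrix (Fin N) (Fin N) ℂ))ᴴ := by
  ext ⟨y, i⟩ ⟨y', i'⟩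
  simp [ampliation, krausMap_apply, Matrix.sum_apply, Matrix.mul_apply, Matrix.kroneckerMap_apply,
    Fintype.sum_prod_type, Matrix.one_apply, apply_ite]

theorem isQuantumChannel_krausMap [DecidableEq X] (K : W → Matrix Y X ℂ)
    (hK : ∑ w, (K w)ᴴ * K w = 1) : IsQuantumChannel (krausMap K) where
  completelyPositive N ρ hρ := by
    rw [ampliation_krausMap]
    exact Matrix.posSemidef_sum _ fun w _ => hρ.mul_mul_conjTranspose_same _
  tracePreserving ρ := by
    rw [krausMap_apply, Matrix.trace_sum]
    rw [Finset.sum_congr rfl fun w _ => Matrix.trace_mul_cycle (K w) ρ (K w)ᴴ,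
      ← Matrix.trace_sum, ← Matrix.sum_mul, hK, Matrix.one_mul]

end Kraus

/-! ## Secret sharing from additive codes -/

section Code

variable {ι F S R : Type*} [Fintype ι] [DecidableEq ι] [Fintype F] [Fintype S] [DecidableEq F]
  [Fintype R]

theorem glue_mem (A : Finset ι) (a : {i // i ∈ A} → F) (e : {i // i ∉ A} → F) (i : ι)
    (hi : i ∈ A) : glue A a e i = a ⟨i, hi⟩ := by
  simp [glue, Equiv.piEquivPiSubtypeProd, hi]

theorem glue_not_mem (A : Finset ι) (a : {i // i ∈ A} → F) (e : {i // i ∉ A} → F) (i : ι)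
    (hi : i ∉ A) : glue A a e i = e ⟨i, hi⟩ := by
  simp [glue, Equiv.piEquivPiSubtypeProd, hi]

theorem sum_glue (A : Finset ι) (f : (ι → F) → ℂ) :
    ∑ a : {i // i ∈ A} → F, ∑ e : {i // i ∉ A} → F, f (glue A a e) = ∑ c, f c := by
  rw [← Fintype.sum_prod_type' (f := fun a e => f (glue A a e))]
  exact Equiv.sum_comp (Equiv.piEquivPiSubtypeProd (fun i => i ∈ A) (fun _ => F)).symm f

/-- The slice of the encoding `E` whose qudits outside `A` are in the basis state `e`. -/
def slice (E : Matrix (ι → F) S ℂ) (A : Finset ι) (e : {i // i ∉ A} → F) :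
    Matrix ({i // i ∈ A} → F) S ℂ :=
  Matrix.of fun a s => E (glue A a e) s

theorem reduced_encoded (E : Matrix (ι → F) S ℂ) (A : Finset ι) (ρ : Matrix S S ℂ) :
    reduced A (E * ρ * Eᴴ) = ∑ e, slice E A e * ρ * (slice E A e)ᴴ := by
  ext a b
  simp [reduced, Matrix.sum_apply, Matrix.mul_apply, slice]

variable [AddCommGroup F] [AddCommGroup S] [AddCommGroup R]

/-- The encoding of `s` as the superposition, with amplitude `α`, of all codewords `φ (s, r)`. -/
def codeEncoding (φ : S × R →+ (ι → F)) (α : ℝ) : Matrix (ι → F) S ℂ :=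
  Matrix.of fun c s => (α : ℂ) * ∑ r : R, if c = φ (s, r) then (1 : ℂ) else 0

theorem exists_of_codeEncoding_ne_zero {φ : S × R →+ (ι → F)} {α : ℝ} {c : ι → F} {s : S}
    (h : codeEncoding φ α c s ≠ 0) : ∃ r, c = φ (s, r) := by
  by_contra! hc
  exact h (by simp [codeEncoding, hc])

/-- Translation by a codeword only permutes the random vectors in the uniform sum. -/
theorem codeEncoding_add (φ : S × R →+ (ι → F)) (α : ℝ) (c : ι → F) (s : S) (r : R) :
    codeEncoding φ α (c + φ (s, r)) s = codeEncoding φ α c 0 := by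
  simp only [codeEncoding, Matrix.of_apply]
  congr 1
  rw [← Equiv.sum_comp (Equiv.addRight r)]
  refine Finset.sum_congr rfl fun t _ => ?_
  have : φ (s, t + r) = φ (0, t) + φ (s, r) := by rw [← map_add]; simp
  simp [this]

theorem codeEncoding_isometry [DecidableEq S] {φ : S × R →+ (ι → F)}
    (hφ : Function.Injective φ) {α : ℝ} (hα : α ^ 2 * Fintype.card R = 1) :
    (codeEncoding φ α)ᴴ * codeEncoding φ α = 1 := by
  classical
  ext s s'
  calc ((codeEncoding φ α)ᴴ * codeEncoding φ α) s s'
      = ∑ c, (α : ℂ) ^ 2 * ∑ r : R, ∑ r' : R,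
          (if c = φ (s, r) then (1 : ℂ) else 0) * (if c = φ (s', r') then (1 : ℂ) else 0) := by
        rw [Matrix.mul_apply]
        refine Finset.sum_congr rfl fun c _ => ?_
        rw [← Finset.sum_mul_sum, Matrix.conjTranspose_apply, codeEncoding, Matrix.of_apply,
          Matrix.of_apply, star_mul', star_sum, sq, mul_mul_mul_comm]
        simp only [RCLike.star_def, Complex.conj_ofReal, apply_ite (starRingEnd ℂ), map_one,
          map_zero]
    _ = (α : ℂ) ^ 2 * ∑ r : R, ∑ r' : R, ∑ c,
          (if c = φ (s, r) then (1 : ℂ) else 0) * (if c = φ (s', r') then (1 : ℂ) else 0) := by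
        rw [← Finset.mul_sum, Finset.sum_comm]
        congr 1
        exact Finset.sum_congr rfl fun r _ => Finset.sum_comm
    _ = (α : ℂ) ^ 2 * ∑ r : R, ∑ r' : R, if s = s' ∧ r = r' then (1 : ℂ) else 0 := by
        simp only [ite_mul, one_mul, zero_mul, Finset.sum_ite_eq',
          Finset.mem_univ, if_true, hφ.eq_iff, Prod.mk.injEq]
    _ = (1 : Matrix S S ℂ) s s' := by
        by_cases hs : s = s'
        · subst hs
          simpa using congrArg (fun t : ℝ => (t : ℂ)) hα
        · simp [hs]

/-- The qudits in `A` of a codeword determine the secret. -/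
def Determines (φ : S × R →+ (ι → F)) (A : Finset ι) : Prop :=
  ∀ s r, (∀ i ∈ A, φ (s, r) i = 0) → s = 0

/-- Every secret has a codeword that vanishes on the qudits in `A`. -/
def Vanishes (φ : S × R →+ (ι → F)) (A : Finset ι) : Prop :=
  ∀ s, ∃ r, ∀ i ∈ A, φ (s, r) i = 0

theorem Determines.eq {φ : S × R →+ (ι → F)} {A : Finset ι} (h : Determines φ A) {s s' : S}
    {r r' : R} (hc : ∀ i ∈ A, φ (s, r) i = φ (s', r') i) : s = s' := by
  refine sub_eq_zero.mp (h (s - s') (r - r') fun i hi => ?_)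
  have : φ (s - s', r - r') = φ (s, r) - φ (s', r') := by rw [← map_sub]; simp
  simp [this, hc i hi]

/-- Coherences between distinct secrets die in the partial trace because the traced-out qudits
reveal the secret. Translating those qudits by a codeword that vanishes on `A` shows that each
diagonal term has the same form as for the secret `0`, so only the trace of `ρ` survives. -/
theorem noInformation_codeEncoding {φ : S × R →+ (ι → F)} {α : ℝ} {A : Finset ι}
    (hA : Vanishes φ A) (hB : Determines φ Aᶜ) : NoInformation (codeEncoding φ α) A := by
  classical
  set E := codeEncoding φ α with hE
  choose r₀ hr₀ using hA
  refine ⟨Matrix.of fun a b => ∑ e, E (glue A a e) 0 * star (E (glue A b e) 0),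
    fun ρ hρ => ?_⟩
  ext a b
  have hoff : ∀ s s' e, s ≠ s' → E (glue A a e) s * ρ s s' * star (E (glue A b e) s') = 0 := by
    intro s s' e hs
    by_contra hne
    have h1 : E (glue A a e) s ≠ 0 := fun h => hne (by simp [h])
    have h2 : E (glue A b e) s' ≠ 0 := fun h => hne (by simp [h])
    obtain ⟨r, hr⟩ := exists_of_codeEncoding_ne_zero h1
    obtain ⟨r', hr'⟩ := exists_of_codeEncoding_ne_zero h2
    refine hs (hB.eq (r := r) (r' := r') fun i hi => ?_)
    rw [Finset.mem_compl] at hi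
    rw [← hr, ← hr', glue_not_mem _ _ _ _ hi, glue_not_mem _ _ _ _ hi]
  have hshift : ∀ s (a : {i // i ∈ A} → F) (e : {i // i ∉ A} → F),
      E (glue A a (e + fun i : {i // i ∉ A} => φ (s, r₀ s) i)) s = E (glue A a e) 0 := by
    intro s a e
    rw [hE, ← codeEncoding_add φ α (glue A a e) s (r₀ s)]
    congr 1
    funext i
    by_cases hi : i ∈ A
    · simp [glue_mem _ _ _ _ hi, hr₀ s i hi]
    · simp [glue_not_mem _ _ _ _ hi]
  have hdiag : ∀ s, ∑ e, E (glue A a e) s * ρ s s * star (E (glue A b e) s) =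
      ρ s s * ∑ e, E (glue A a e) 0 * star (E (glue A b e) 0) := by
    intro s
    rw [← Equiv.sum_comp (Equiv.addRight fun i : {i // i ∉ A} => φ (s, r₀ s) i), Finset.mul_sum]
    refine Finset.sum_congr rfl fun e _ => ?_
    rw [Equiv.coe_addRight, hshift, hshift]
    ring
  calc reduced A (E * ρ * Eᴴ) a b
      = ∑ e, ∑ s', ∑ s, E (glue A a e) s * ρ s s' * star (E (glue A b e) s') := by
        simp [reduced_encoded, Matrix.sum_apply, Matrix.mul_apply, slice, Finset.sum_mul]
    _ = ∑ e, ∑ s, E (glue A a e) s * ρ s s * star (E (glue A b e) s) := by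
        refine Finset.sum_congr rfl fun e _ => Finset.sum_congr rfl fun s' _ => ?_
        exact Finset.sum_eq_single s' (fun s _ hs => hoff s s' e hs) (by simp)
    _ = ρ.trace * ∑ e, E (glue A a e) 0 * star (E (glue A b e) 0) := by
        rw [Finset.sum_comm, Matrix.trace, Finset.sum_mul]
        exact Finset.sum_congr rfl fun s _ => hdiag s
    _ = _ := by rw [hρ.trace_eq_one, one_mul, Matrix.of_apply]

/-- The decoder reads the secret `s` off `A` coherently and subtracts a codeword for `s` supported
on `A`. What is left is the encoding of `0`, unentangled with the secret, and it is discarded. -/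
theorem canRecover_codeEncoding {φ : S × R →+ (ι → F)} (hφ : Function.Injective φ) {α : ℝ}
    (hα : α ^ 2 * Fintype.card R = 1) {A : Finset ι}
    (hA : Determines φ A) (hB : Vanishes φ Aᶜ) : CanRecover (codeEncoding φ α) A := by
  classical
  set E := codeEncoding φ α with hE
  choose r₀ hr₀ using hB
  let t : S → {i // i ∈ A} → F := fun s i => φ (s, r₀ s) i
  -- The default `0` on labels that extend to no codeword is arbitrary: the Kraus operators are
  -- trace preserving for any `g`.
  let g : ({i // i ∈ A} → F) → S := fun a =>
    if h : ∃ s r, ∀ i : {i // i ∈ A}, φ (s, r) i = a i then h.choose else 0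
  have hg : ∀ s e a, E (glue A a e) s ≠ 0 → g a = s := by
    intro s e a h
    obtain ⟨r, hr⟩ := exists_of_codeEncoding_ne_zero h
    have hr' : ∀ i : {i // i ∈ A}, φ (s, r) i = a i := fun i => by
      rw [← hr, glue_mem _ _ _ _ i.2]
    have hex : ∃ s r, ∀ i : {i // i ∈ A}, φ (s, r) i = a i := ⟨s, r, hr'⟩
    obtain ⟨r₁, hr₁⟩ := hex.choose_spec
    simp only [g, dif_pos hex]
    exact hA.eq (r := r₁) (r' := r) fun i hi => (hr₁ ⟨i, hi⟩).trans (hr' ⟨i, hi⟩).symm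
  -- Kraus operators of the isometry `a ↦ (g a, a - t (g a))` followed by tracing out the second
  -- register, whose basis label is `w`.
  let K : ({i // i ∈ A} → F) → Matrix S ({i // i ∈ A} → F) ℂ := fun w =>
    Matrix.of fun s a => if a = w + t s ∧ g a = s then 1 else 0
  have hK : ∑ w, (K w)ᴴ * K w = 1 := by
    ext a a'
    simp only [Matrix.sum_apply, Matrix.mul_apply, Matrix.conjTranspose_apply, K, Matrix.of_apply]
    rw [Finset.sum_eq_single (a - t (g a)), Finset.sum_eq_single (g a)]
    · by_cases h : a = a'
      · subst h; simp
      · rw [Matrix.one_apply_ne h, if_neg (c := a' = _ ∧ _), mul_zero]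
        rintro ⟨h', -⟩
        exact h (by simpa using h'.symm)
    · intro s _ hs
      rw [if_neg fun h => hs h.2.symm]; simp
    · simp
    · intro w _ hw
      refine Finset.sum_eq_zero fun s _ => ?_
      rw [if_neg]
      · simp
      · rintro ⟨h, rfl⟩
        exact hw (eq_sub_of_add_eq h.symm)
    · simp
  have hshift : ∀ s (w : {i // i ∈ A} → F) (e : {i // i ∉ A} → F),
      E (glue A (w + t s) e) s = E (glue A w e) 0 := by
    intro s w e
    rw [hE, ← codeEncoding_add φ α (glue A w e) s (r₀ s)]
    congr 1
    funext i
    by_cases hi : i ∈ A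
    · simp [glue_mem _ _ _ _ hi, t]
    · simp [glue_not_mem _ _ _ _ hi, hr₀ s i (Finset.mem_compl.mpr hi)]
  have hKE : ∀ w e, K w * slice E A e = E (glue A w e) 0 • (1 : Matrix S S ℂ) := by
    intro w e
    ext s s'
    simp only [Matrix.mul_apply, K, Matrix.of_apply, slice, Matrix.smul_apply, smul_eq_mul]
    rw [Finset.sum_eq_single (w + t s)]
    · by_cases hs : s = s'
      · subst hs
        rw [Matrix.one_apply_eq, hshift, mul_one]
        by_cases h0 : E (glue A w e) 0 = 0
        · simp [h0]
        · rw [if_pos ⟨rfl, hg s e _ (by rwa [hshift])⟩, one_mul]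
      · rw [Matrix.one_apply_ne hs, mul_zero]
        by_cases h0 : E (glue A (w + t s) e) s' = 0
        · simp [h0]
        · rw [if_neg, zero_mul]
          rw [hg s' e _ h0]
          exact fun h => hs h.2.symm
    · intro a _ ha
      rw [if_neg fun h => ha h.1, zero_mul]
    · simp
  have hnorm : ∑ w, ∑ e, E (glue A w e) 0 * star (E (glue A w e) 0) = 1 := by
    rw [sum_glue A fun c => E c 0 * star (E c 0)]
    have := congrFun (congrFun (codeEncoding_isometry hφ hα) 0) 0
    rw [Matrix.one_apply_eq, Matrix.mul_apply] at this
    rw [← this]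
    exact Finset.sum_congr rfl fun c _ => by rw [Matrix.conjTranspose_apply, mul_comm]
  refine ⟨krausMap K, isQuantumChannel_krausMap K hK, fun ρ _ => ?_⟩
  rw [reduced_encoded, krausMap_apply]
  calc ∑ w, K w * (∑ e, slice E A e * ρ * (slice E A e)ᴴ) * (K w)ᴴ
      = ∑ w, ∑ e, (K w * slice E A e) * ρ * (K w * slice E A e)ᴴ := by
        simp only [Matrix.mul_sum, Matrix.sum_mul, Matrix.conjTranspose_mul, Matrix.mul_assoc]
    _ = (∑ w, ∑ e, E (glue A w e) 0 * star (E (glue A w e) 0)) • ρ := by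
        simp only [hKE, Finset.sum_smul, Matrix.conjTranspose_smul, Matrix.conjTranspose_one,
          Matrix.smul_mul, Matrix.mul_smul, Matrix.one_mul, Matrix.mul_one, smul_smul, mul_comm]
    _ = ρ := by rw [hnorm, one_smul]

end Code

theorem not_canRecover_of_noInformation {ι F S : Type*} [Fintype ι] [DecidableEq ι]
    [Fintype F] [Fintype S] [DecidableEq S] [Nontrivial S] {E : Matrix (ι → F) S ℂ} {A : Finset ι} (h : NoInformation E A) : ¬ CanRecover E A := by
  rintro ⟨Φ, -, hΦ⟩
  obtain ⟨σ, hσ⟩ := h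
  have hpure : ∀ s : S, IsDensity (Matrix.single s s (1 : ℂ)) := fun s =>
    ⟨by
      have : Matrix.single s s (1 : ℂ) = Matrix.diagonal (Pi.single s 1) := by
        rw [Matrix.diagonal_single]
      rw [this, Matrix.posSemidef_diagonal_iff]
      intro i
      by_cases hi : i = s
      · subst hi; simp
      · simp [hi], by simp⟩
  obtain ⟨s, s', hs⟩ := exists_pair_ne S
  have h1 := hΦ _ (hpure s)
  have h2 := hΦ _ (hpure s')
  rw [hσ _ (hpure s)] at h1
  rw [hσ _ (hpure s'), h1] at h2
  have := congrFun (congrFun h2 s) s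
  simp [hs.symm] at this


/-! ## Vandermonde systems -/

section Vandermonde

open Polynomial

variable {F : Type*} [Field F] {n d : ℕ} {x : Fin n → F}

/-- The entries of `w` are the coefficients of `X ^ lo * p` with `p` of degree below `N`. At nonzero
nodes the factor `X ^ lo` cancels, so `p` has too many roots. -/
theorem eq_zero_of_vandermonde_window (hx : Function.Injective x) (hx0 : ∀ i, x i ≠ 0)
    {lo N : ℕ} {T : Finset (Fin n)} (hT : N ≤ T.card) {w : Fin d → F}
    (hw : ∀ a, w a ≠ 0 → lo ≤ a.val ∧ a.val < lo + N)
    (hz : ∀ i ∈ T, ∑ a, x i ^ a.val * w a = 0) : w = 0 := by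
  let P : F[X] := ∑ a : Fin d, monomial a.val (w a)
  have hcoeff : ∀ c, P.coeff c ≠ 0 → ∃ a : Fin d, a.val = c ∧ w a ≠ 0 := by
    intro c hc
    by_contra! h
    refine hc ?_
    rw [finsetSum_coeff]
    refine Finset.sum_eq_zero fun a _ => ?_
    rw [coeff_monomial]
    split_ifs with hac
    · exact h a hac
    · rfl
  have hwP : ∀ a : Fin d, w a = P.coeff a := by
    intro a
    rw [finsetSum_coeff, Finset.sum_eq_single a]
    · simp
    · intro b _ hb
      rw [coeff_monomial, if_neg fun h => hb (Fin.ext h)]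
    · simp
  obtain ⟨p, hp⟩ : X ^ lo ∣ P := by
    rw [X_pow_dvd_iff]
    intro c hc
    by_contra h
    obtain ⟨a, rfl, ha⟩ := hcoeff c h
    exact absurd (hw a ha).1 (by omega)
  have hp0 : p = 0 := by
    refine eq_zero_of_degree_lt_of_eval_index_eq_zero (s := T) hx.injOn ?_ fun i hi => ?_
    · refine lt_of_lt_of_le ((degree_lt_iff_coeff_zero p N).mpr fun c hc => ?_)
        (Nat.cast_le.mpr hT)
      by_contra h
      have : P.coeff (c + lo) ≠ 0 := by rwa [hp, coeff_X_pow_mul]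
      obtain ⟨a, hac, ha⟩ := hcoeff _ this
      exact absurd (hw a ha).2 (by omega)
    · have : P.eval (x i) = 0 := by
        rw [← hz i hi, eval_finsetSum]
        exact Finset.sum_congr rfl fun a _ => by rw [eval_monomial, mul_comm]
      rw [hp, eval_mul, eval_pow, eval_X] at this
      exact (mul_eq_zero.mp this).resolve_left (pow_ne_zero _ (hx0 i))
  funext a
  rw [hwP, hp, hp0, mul_zero, coeff_zero, Pi.zero_apply]

/-- Interpolate the values `y i / x i ^ lo` and multiply by `X ^ lo`. -/
theorem exists_vandermonde_window (hx : Function.Injective x) (hx0 : ∀ i, x i ≠ 0)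
    {lo N : ℕ} (hd : lo + N ≤ d) {T : Finset (Fin n)} (hT : T.card ≤ N) (y : Fin n → F) :
    ∃ w : Fin d → F, (∀ a, w a ≠ 0 → lo ≤ a.val ∧ a.val < lo + N) ∧
      ∀ i ∈ T, ∑ a, x i ^ a.val * w a = y i := by
  let p : F[X] := Lagrange.interpolate T x fun i => y i / x i ^ lo
  have hp : p.degree < N :=
    lt_of_lt_of_le (Lagrange.degree_interpolate_lt _ hx.injOn) (Nat.cast_le.mpr hT)
  have hcoeff : ∀ c, (X ^ lo * p).coeff c ≠ 0 → lo ≤ c ∧ c < lo + N := by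
    intro c hc
    rw [coeff_X_pow_mul'] at hc
    have hlo : lo ≤ c := by
      by_contra h
      exact hc (if_neg h)
    rw [if_pos hlo] at hc
    refine ⟨hlo, ?_⟩
    by_contra h
    exact hc ((degree_lt_iff_coeff_zero p N).mp hp _ (by omega))
  refine ⟨fun a => (X ^ lo * p).coeff a, fun a ha => hcoeff a ha, fun i hi => ?_⟩
  have hdeg : (X ^ lo * p).degree < (d : WithBot ℕ) := (degree_lt_iff_coeff_zero _ d).mpr fun c hc => by
    by_contra h
    exact absurd (hcoeff c h).2 (by omega)
  calc ∑ a : Fin d, x i ^ a.val * (X ^ lo * p).coeff a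
      = (X ^ lo * p).sum fun a b => x i ^ a * b :=
        Polynomial.sum_fin (fun a b => x i ^ a * b) (fun a => mul_zero _) hdeg
    _ = (X ^ lo * p).eval (x i) := by simp only [eval_eq_sum, mul_comm]
    _ = y i := by
        rw [eval_mul, eval_pow, eval_X, Lagrange.eval_interpolate_at_node _ hx.injOn hi,
          mul_div_cancel₀ _ (pow_ne_zero _ (hx0 i))]

end Vandermonde

/-! ## The staircase code -/

section Staircase

theorem messageMatrix_add {F : Type*} [AddCommGroup F] {k m d : ℕ} (hmk : m ≤ k)
    (hd : d + 1 = m + k) (s s' : Fin m → F) (r r' : Fin m → Fin (k - 1) → F) :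
    messageMatrix hmk hd (s + s') (r + r') =
      messageMatrix hmk hd s r + messageMatrix hmk hd s' r' := by
  ext a j
  simp only [messageMatrix, Matrix.of_apply, Matrix.add_apply, Pi.add_apply]
  split_ifs <;> simp

variable {F : Type*} [Field F] {k m d n : ℕ} (hmk : m ≤ k) (hd : d + 1 = m + k)

theorem messageMatrix_tail (s : Fin m → F) (r : Fin m → Fin (k - 1) → F) (a : Fin d) (j : Fin m)
    (ha : m ≤ a.val) :
    messageMatrix hmk hd s r a j = r j ⟨a.val - m, by have := a.isLt; omega⟩ := by
  have h1 : ¬ a.val < m := by omega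
  have h2 : ¬ a.val + 1 < m := by omega
  have h3 : a.val + 1 ≠ m := by omega
  simp [messageMatrix, h1, h2, h3]

/-- This lets the tail of the first column be chosen before the tails of the others. -/
theorem messageMatrix_head_congr {s : Fin m → F} {r r' : Fin m → Fin (k - 1) → F} (a : Fin d)
    (j : Fin m) (ha : a.val < m) (h : j.val ≠ 0 → r ⟨0, j.pos⟩ = r' ⟨0, j.pos⟩) :
    messageMatrix hmk hd s r a j = messageMatrix hmk hd s r' a j := by
  by_cases hj : j.val = 0
  · simp [messageMatrix, hj, ha]
  · have h3 : a.val + 1 = m ∨ a.val + 1 < m := by omega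
    rcases h3 with h3 | h3
    · simp [messageMatrix, hj, h3, h hj]
    · simp [messageMatrix, hj, h3]

theorem messageMatrix_secret (s : Fin m → F) (r : Fin m → Fin (k - 1) → F) (a : Fin d)
    (j : Fin m) (hj : j.val = 0) (ha : a.val < m) :
    messageMatrix hmk hd s r a j = s ⟨a.val, ha⟩ := by
  simp [messageMatrix, hj, ha]

theorem messageMatrix_corner (s : Fin m → F) (r : Fin m → Fin (k - 1) → F) (a : Fin d)
    (j : Fin m) (hj : j.val ≠ 0) (ha : a.val + 1 = m) :
    messageMatrix hmk hd s r a j =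
      r ⟨0, j.pos⟩ ⟨k - m + (j.val - 1), by have := j.isLt; omega⟩ := by
  simp [messageMatrix, hj, ha]

theorem messageMatrix_zero (s : Fin m → F) (r : Fin m → Fin (k - 1) → F) (a : Fin d)
    (j : Fin m) (hj : j.val ≠ 0) (ha : a.val + 1 < m) :
    messageMatrix hmk hd s r a j = 0 := by
  simp [messageMatrix, hj, ha]

theorem codeword_apply (x : Fin n → F) (s : Fin m → F) (r : Fin m → Fin (k - 1) → F)
    (i : Fin n) (j : Fin m) :
    codeword hmk hd x s r (i, j) = ∑ a : Fin d, x i ^ a.val * messageMatrix hmk hd s r a j := by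
  simp [codeword, vandermonde, Matrix.mul_apply]

/-- `codeword` as an additive map. -/
def codewordHom (x : Fin n → F) :
    (Fin m → F) × (Fin m → Fin (k - 1) → F) →+ (Fin n × Fin m → F) :=
  AddMonoidHom.mk' (fun p => codeword hmk hd x p.1 p.2) fun p p' => by
    funext c
    simp [codeword, messageMatrix_add, Matrix.mul_add]

theorem eq_zero_of_column_eq_zero {s : Fin m → F} {r : Fin m → Fin (k - 1) → F} {j : Fin m}
    (h : (fun a => messageMatrix hmk hd s r a j) = 0) : r j = 0 := by
  funext b
  have := congrFun h ⟨m + b.val, by have := b.isLt; omega⟩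
  rw [messageMatrix_tail hmk hd s r _ j (by simp)] at this
  simpa using this

theorem secret_eq_zero_of_column_eq_zero (hk : 1 ≤ k) {s : Fin m → F}
    {r : Fin m → Fin (k - 1) → F} {j : Fin m} (hj : j.val = 0)
    (h : (fun a => messageMatrix hmk hd s r a j) = 0) : s = 0 := by
  funext b
  have := congrFun h ⟨b.val, by have := b.isLt; omega⟩
  rw [messageMatrix_secret hmk hd s r _ j hj b.isLt] at this
  simpa using this

variable {x : Fin n → F}

theorem eq_zero_of_codeword_eq_zero (hx : Function.Injective x) (hx0 : ∀ i, x i ≠ 0)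
    (hk : 1 ≤ k) (hm : 1 ≤ m) {T : Finset (Fin n)}
    (hT : k ≤ T.card) {s : Fin m → F} {r : Fin m → Fin (k - 1) → F}
    (hz : ∀ i ∈ T, ∀ j, codeword hmk hd x s r (i, j) = 0) : s = 0 ∧ r = 0 := by
  simp only [codeword_apply] at hz
  have hcol : ∀ j : Fin m, j.val ≠ 0 → (fun a => messageMatrix hmk hd s r a j) = 0 := by
    intro j hj
    refine eq_zero_of_vandermonde_window hx hx0 (lo := m - 1) hT (fun a ha => ?_)
      fun i hi => hz i hi j
    refine ⟨?_, by have := a.isLt; omega⟩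
    by_contra h
    exact ha (messageMatrix_zero hmk hd s r a j hj (by omega))
  have hcol0 : (fun a => messageMatrix hmk hd s r a ⟨0, hm⟩) = 0 := by
    refine eq_zero_of_vandermonde_window hx hx0 (lo := 0) hT (fun a ha => ?_)
      fun i hi => hz i hi ⟨0, hm⟩
    refine ⟨Nat.zero_le _, ?_⟩
    by_contra h
    have had := a.isLt
    refine ha ?_
    -- Row `a ≥ k` of the first column holds `r 0 (a - m)`, which reappears as the corner entry of
    -- column `a - k + 1`.
    have h1 := congrFun (hcol ⟨a.val - k + 1, by omega⟩ (by simp)) ⟨m - 1, by omega⟩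
    rw [messageMatrix_corner hmk hd s r _ _ (by simp) (by simp only; omega)] at h1
    rw [messageMatrix_tail hmk hd s r _ _ (by omega)]
    refine Eq.trans ?_ h1
    congr 1
    ext
    simp only
    omega
  refine ⟨secret_eq_zero_of_column_eq_zero hmk hd hk (j := ⟨0, hm⟩) rfl hcol0, ?_⟩
  funext j
  by_cases hj : j.val = 0
  · obtain rfl : j = ⟨0, hm⟩ := Fin.ext hj
    exact eq_zero_of_column_eq_zero hmk hd hcol0
  · exact eq_zero_of_column_eq_zero hmk hd (hcol j hj)

theorem secret_eq_zero_of_first_eq_zero (hx : Function.Injective x) (hx0 : ∀ i, x i ≠ 0)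
    (hk : 1 ≤ k) (hm : 1 ≤ m) {D : Finset (Fin n)}
    (hD : d ≤ D.card) {s : Fin m → F} {r : Fin m → Fin (k - 1) → F}
    (hz : ∀ i ∈ D, codeword hmk hd x s r (i, ⟨0, hm⟩) = 0) : s = 0 := by
  simp only [codeword_apply] at hz
  refine secret_eq_zero_of_column_eq_zero hmk hd hk (r := r) (j := ⟨0, hm⟩) rfl ?_
  exact eq_zero_of_vandermonde_window hx hx0 (lo := 0) hD
    (fun a _ => ⟨Nat.zero_le _, by have := a.isLt; omega⟩) hz

/-- Once the top `m` entries of a column are fixed, `N` consecutive free entries below them suffice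
to cancel its values at `N` nodes; the rest of the tail stays zero. -/
theorem exists_tail (hx : Function.Injective x) (hx0 : ∀ i, x i ≠ 0)
    {N : ℕ} (hN : m + N ≤ d) {T : Finset (Fin n)} (hT : T.card ≤ N)
    (p : Fin d → F) :
    ∃ t : Fin (k - 1) → F, (∀ b, N ≤ b.val → t b = 0) ∧ ∀ i ∈ T, ∑ a : Fin d, x i ^ a.val *
      (if _h : a.val < m then p a else t ⟨a.val - m, by have := a.isLt; omega⟩) = 0 := by
  obtain ⟨w, hw, hwT⟩ := exists_vandermonde_window hx hx0 hN hT
    (fun i => -∑ a : Fin d, x i ^ a.val * (if a.val < m then p a else 0))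
  refine ⟨fun b => w ⟨m + b.val, by have := b.isLt; omega⟩, fun b hb => ?_, fun i hi => ?_⟩
  · by_contra h
    have := (hw _ h).2
    simp only at this
    omega
  · have h := hwT i hi
    rw [eq_neg_iff_add_eq_zero, ← Finset.sum_add_distrib] at h
    rw [← h]
    refine Finset.sum_congr rfl fun a _ => ?_
    rw [← mul_add]
    congr 1
    split_ifs with ha
    · have : w a = 0 := by
        by_contra h
        exact absurd (hw a h).1 (by omega)
      rw [this, zero_add]
    · rw [add_zero]
      have hfin : a = ⟨m + (a.val - m), by have := a.isLt; omega⟩ :=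
        Fin.ext (Nat.add_sub_cancel' (not_lt.mp ha)).symm
      exact (congrArg w hfin).symm

theorem exists_codeword_eq_zero (hx : Function.Injective x) (hx0 : ∀ i, x i ≠ 0)
    (hk : 1 ≤ k) (hm : 1 ≤ m) {T : Finset (Fin n)}
    (hT : T.card < k) (s : Fin m → F) :
    ∃ r, ∀ i ∈ T, ∀ j, codeword hmk hd x s r (i, j) = 0 := by
  have key := fun p => exists_tail hd hx hx0 (N := k - 1) (by omega) (T := T) (by omega) p
  obtain ⟨t₀, -, ht₀⟩ := key fun a => messageMatrix hmk hd s 0 a ⟨0, hm⟩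
  choose t _ ht using fun j => key fun a => messageMatrix hmk hd s (fun _ => t₀) a j
  refine ⟨fun j => if j.val = 0 then t₀ else t j, fun i hi j => ?_⟩
  rw [codeword_apply]
  by_cases hj : j.val = 0
  · obtain rfl : j = ⟨0, hm⟩ := Fin.ext hj
    rw [← ht₀ i hi]
    refine Finset.sum_congr rfl fun a _ => ?_
    congr 1
    split_ifs with ha
    · exact messageMatrix_head_congr hmk hd a _ ha fun h => absurd rfl h
    · rw [messageMatrix_tail hmk hd _ _ _ _ (by omega), if_pos hj]
  · rw [← ht j i hi]
    refine Finset.sum_congr rfl fun a _ => ?_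
    congr 1
    split_ifs with ha
    · exact messageMatrix_head_congr hmk hd a _ ha fun _ => if_pos rfl
    · rw [messageMatrix_tail hmk hd _ _ _ _ (by omega), if_neg hj]

theorem exists_codeword_first_eq_zero (hx : Function.Injective x) (hx0 : ∀ i, x i ≠ 0)
    (hm : 1 ≤ m) {T : Finset (Fin n)}
    (hT : T.card + m ≤ k) (s : Fin m → F) :
    ∃ r, ∀ i j, (j.val = 0 → i ∈ T) → codeword hmk hd x s r (i, j) = 0 := by
  -- Only the first `k - m` tail entries are used, so the last `m - 1`, which feed the corners, stay
  -- zero and all later columns can be zero.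
  obtain ⟨t, htz, ht⟩ := exists_tail hd hx hx0 (N := k - m) (by omega) (T := T) (by omega)
    fun a => messageMatrix hmk hd s 0 a ⟨0, hm⟩
  refine ⟨fun j => if j.val = 0 then t else 0, fun i j hij => ?_⟩
  rw [codeword_apply]
  by_cases hj : j.val = 0
  · obtain rfl : j = ⟨0, hm⟩ := Fin.ext hj
    rw [← ht i (hij rfl)]
    refine Finset.sum_congr rfl fun a _ => ?_
    congr 1
    split_ifs with ha
    · exact messageMatrix_head_congr hmk hd a _ ha fun h => absurd rfl h
    · rw [messageMatrix_tail hmk hd _ _ _ _ (by omega), if_pos hj]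
  · refine Finset.sum_eq_zero fun a _ => ?_
    rcases lt_trichotomy (a.val + 1) m with ha | ha | ha
    · rw [messageMatrix_zero hmk hd _ _ _ _ hj ha, mul_zero]
    · rw [messageMatrix_corner hmk hd _ _ _ _ hj ha, if_pos rfl, htz _ (by simp), mul_zero]
    · rw [messageMatrix_tail hmk hd _ _ _ _ (by omega), if_neg hj, Pi.zero_apply, mul_zero]

theorem encoding_eq_codeEncoding [Fintype F] [DecidableEq F] (x : Fin n → F) :
    encoding hmk hd x = codeEncoding (codewordHom hmk hd x)
      (Real.sqrt ((Fintype.card F : ℝ) ^ (m * (k - 1))))⁻¹ := rfl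

theorem encoding_amplitude [Fintype F] :
    (Real.sqrt ((Fintype.card F : ℝ) ^ (m * (k - 1))))⁻¹ ^ 2 *
      (Fintype.card (Fin m → Fin (k - 1) → F) : ℝ) = 1 := by
  have hF : (0 : ℝ) < Fintype.card F := by exact_mod_cast Fintype.card_pos
  rw [inv_pow, Real.sq_sqrt (by positivity)]
  simp only [Fintype.card_fun, Fintype.card_fin]
  rw [← pow_mul, mul_comm (k - 1) m, Nat.cast_pow]
  exact inv_mul_cancel₀ (by positivity)

end Staircase

/-! ### Threshold and communication properties of the staircase encoding -/

section Main

variable {F : Type*} [Field F] {k m d n : ℕ} {hmk : m ≤ k} {hd : d + 1 = m + k}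
  {x : Fin n → F}

theorem codewordHom_injective (hx : Function.Injective x) (hx0 : ∀ i, x i ≠ 0) (hk : 1 ≤ k)
    (hm : 1 ≤ m) (hn : k ≤ n) : Function.Injective (codewordHom hmk hd x) := by
  rw [injective_iff_map_eq_zero]
  rintro ⟨s, r⟩ h
  obtain ⟨hs, hr⟩ := eq_zero_of_codeword_eq_zero hmk hd hx hx0 hk hm (T := Finset.univ)
    (by simpa using hn) (s := s) (r := r) fun i _ j => congrFun h (i, j)
  rw [hs, hr, Prod.mk_zero_zero]

theorem determines_shareQudits (hx : Function.Injective x) (hx0 : ∀ i, x i ≠ 0) (hk : 1 ≤ k)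
    (hm : 1 ≤ m) {T : Finset (Fin n)} (hT : k ≤ T.card) :
    Determines (codewordHom hmk hd x) (shareQudits T) := fun s r h =>
  (eq_zero_of_codeword_eq_zero hmk hd hx hx0 hk hm hT (r := r) fun i hi j =>
    h (i, j) (by simp [shareQudits, hi])).1

theorem vanishes_shareQudits (hx : Function.Injective x) (hx0 : ∀ i, x i ≠ 0) (hk : 1 ≤ k)
    (hm : 1 ≤ m) {T : Finset (Fin n)} (hT : T.card < k) :
    Vanishes (codewordHom hmk hd x) (shareQudits T) := fun s => by
  obtain ⟨r, hr⟩ := exists_codeword_eq_zero hmk hd hx hx0 hk hm hT s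
  refine ⟨r, fun p hp => hr p.1 ?_ p.2⟩
  simpa [shareQudits] using hp

theorem compl_shareQudits (T : Finset (Fin n)) :
    (shareQudits T)ᶜ = shareQudits (m := m) Tᶜ := by
  ext p
  simp [shareQudits]

theorem card_firstQudits (hm : 1 ≤ m) (D : Finset (Fin n)) :
    (firstQudits (m := m) D).card = D.card := by
  have : (Finset.univ.filter fun j : Fin m => j.val = 0) = {⟨0, hm⟩} := by
    ext j
    simp [Fin.ext_iff]
  rw [firstQudits, Finset.card_product, this, Finset.card_singleton, mul_one]

variable [Fintype F] [DecidableEq F]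

theorem canRecover_shareQudits (hx : Function.Injective x) (hx0 : ∀ i, x i ≠ 0) (hk : 1 ≤ k)
    (hm : 1 ≤ m) (hn : n ≤ 2 * k - 1) {T : Finset (Fin n)} (hT : k ≤ T.card) :
    CanRecover (encoding hmk hd x) (shareQudits T) := by
  have hTn := T.card_le_univ
  rw [Fintype.card_fin] at hTn
  rw [encoding_eq_codeEncoding]
  refine canRecover_codeEncoding (codewordHom_injective hx hx0 hk hm (by omega))
    encoding_amplitude (determines_shareQudits hx hx0 hk hm hT) ?_
  rw [compl_shareQudits]
  refine vanishes_shareQudits hx hx0 hk hm ?_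
  rw [Finset.card_compl, Fintype.card_fin]
  omega

theorem noInformation_shareQudits (hx : Function.Injective x) (hx0 : ∀ i, x i ≠ 0) (hk : 1 ≤ k)
    (hm : 1 ≤ m) (hn : 2 * k - 1 ≤ n) {T : Finset (Fin n)} (hT : T.card < k) :
    NoInformation (encoding hmk hd x) (shareQudits T) := by
  rw [encoding_eq_codeEncoding]
  refine noInformation_codeEncoding (vanishes_shareQudits hx hx0 hk hm hT) ?_
  rw [compl_shareQudits]
  refine determines_shareQudits hx hx0 hk hm ?_
  rw [Finset.card_compl, Fintype.card_fin]
  omega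

theorem canRecover_firstQudits (hx : Function.Injective x) (hx0 : ∀ i, x i ≠ 0) (hk : 1 ≤ k)
    (hm : 1 ≤ m) (hn : n ≤ 2 * k - 1) {D : Finset (Fin n)} (hD : D.card = d) :
    CanRecover (encoding hmk hd x) (firstQudits D) := by
  have hDn := D.card_le_univ
  rw [Fintype.card_fin] at hDn
  rw [encoding_eq_codeEncoding]
  refine canRecover_codeEncoding (codewordHom_injective hx hx0 hk hm (by omega))
    encoding_amplitude (fun s r h => ?_) fun s => ?_
  · exact secret_eq_zero_of_first_eq_zero hmk hd hx hx0 hk hm hD.ge (r := r) fun i hi =>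
      h (i, ⟨0, hm⟩) (by simp [firstQudits, hi])
  · obtain ⟨r, hr⟩ := exists_codeword_first_eq_zero hmk hd hx hx0 hm (T := Dᶜ)
      (by rw [Finset.card_compl, Fintype.card_fin]; omega) s
    refine ⟨r, fun p hp => hr p.1 p.2 fun h0 => ?_⟩
    simpa [firstQudits, h0] using hp

theorem isThresholdScheme_encoding (hx : Function.Injective x) (hx0 : ∀ i, x i ≠ 0)
    (hk : 1 ≤ k) (hm : 1 ≤ m) (hn : n = 2 * k - 1) :
    IsThresholdScheme k (encoding hmk hd x) where
  isometry := by
    rw [encoding_eq_codeEncoding]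
    exact codeEncoding_isometry (codewordHom_injective hx hx0 hk hm (by omega))
      encoding_amplitude
  recover _ hT := canRecover_shareQudits hx hx0 hk hm hn.le hT
  secrecy _ hT := noInformation_shareQudits hx hx0 hk hm hn.ge hT
  complement T hT := by
    -- Makes the secret space nontrivial; otherwise recovery and absence of information would not
    -- exclude each other.
    have : Nonempty (Fin m) := ⟨⟨0, hm⟩⟩
    have hTk : k ≤ T.card := by
      by_contra h
      exact not_canRecover_of_noInformation
        (noInformation_shareQudits hx hx0 hk hm hn.ge (not_le.mp h)) hT
    refine noInformation_shareQudits hx hx0 hk hm hn.ge ?_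
    rw [Finset.card_compl, Fintype.card_fin]
    omega

end Main

end QSS

theorem mainTheorem1 (k d m q : ℕ) [Fact q.Prime] (hk : 1 ≤ k) (hkd : k ≤ d)
    (hd : d ≤ 2 * k - 1) (hq : 2 * k - 1 < q) (hm : m = d - k + 1)
    (x : Fin (2 * k - 1) → ZMod q) (hx : Function.Injective x) (hx0 : ∀ i, x i ≠ 0)
    (E : Matrix (Fin (2 * k - 1) × Fin m → ZMod q) (Fin m → ZMod q) ℂ)
    (hE : E = QSS.encoding (k := k) (m := m) (d := d) (by omega) (by omega) x) :
    QSS.IsThresholdScheme k E ∧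
    (∀ K : Finset (Fin (2 * k - 1)), K.card = k →
      (QSS.shareQudits (m := m) K).card = m * k ∧ QSS.CanRecover E (QSS.shareQudits K)) ∧
    (∀ D : Finset (Fin (2 * k - 1)), D.card = d →
      (QSS.firstQudits (m := m) D).card = d ∧ QSS.CanRecover E (QSS.firstQudits D)) ∧
    (k < d → d < m * k) := by
  subst hE
  have hm1 : 1 ≤ m := by omega
  refine ⟨QSS.isThresholdScheme_encoding hx hx0 hk hm1 rfl, fun K hK => ⟨?_, ?_⟩,
    fun D hD => ⟨?_, ?_⟩, fun hkd' => ?_⟩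
  · rw [QSS.shareQudits, Finset.card_product, hK, Finset.card_univ, Fintype.card_fin, mul_comm]
  · exact QSS.canRecover_shareQudits hx hx0 hk hm1 le_rfl hK.ge
  · rw [QSS.card_firstQudits hm1, hD]
  · exact QSS.canRecover_firstQudits hx hx0 hk hm1 le_rfl hD
  -- Here `d = m + k - 1`, so the claim is `(m - 1) * (k - 1) > 0`; `k < d` gives `m ≥ 2`, and then
  -- `k ≥ m ≥ 2`.
  · obtain ⟨a, rfl⟩ : ∃ a, m = a + 2 := ⟨m - 2, by omega⟩
    obtain ⟨b, rfl⟩ : ∃ b, k = b + 2 := ⟨k - 2, by omega⟩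
    have : d = a + b + 3 := by omega
    rw [this]
    nlinarith [Nat.zero_le (a * b)]
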